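/- Let $K$ be a finite (abstract) simplicial complex, i.e. a finite set of nonempty finite sets closed under passing to nonempty subsets ($K=\emptyset$ allowed). For $p\in\mathbb Z$ let $K^{(p)}$ be the set of simplices of $K$ with $p+1$ elements, and let $K[p]$ be the $\mathbb Z_2$-vector space of subsets of $K^{(p)}$ under symmetric difference. Let $\partial_p:K[p]\to K[p-1]$ and $\delta_p:K[p]\to K[p+1]$ be the linear maps with $\partial(\sigma)=\{\tau\in K^{(p-1)}\mid\tau\subset\sigma\}$ and $\delta(\sigma)=\{\tau\in K^{(p+1)}\mid\sigma\subset\tau\}$ for $\sigma\in K^{(p)}$. A *Morse sequence* on $K$ is a sequence $\overrightarrow W=\langle\emptyset=K_0,\dots,K_k=K\rangle$ of simplicial complexes such that, for each $i\in[1,k]$, either (filling) $K_{i-1}=K_i\setminus\{\nu\}$ with $\nu$ a facet of $K_i$, in which case $\nu$ is called *critical*; or (expansion) $K_{i-1}=K_i\setminus\{\sigma,\tau\}$, where $\sigma\subsetneq\tau$ are simplices of $K_i$ and $\tau$ is the only simplex of $K_i$ properly containing $\sigma$, in which case $(\sigma,\tau)$ is called a *regular pair*, $\sigma$ *lower regular*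 and $\tau$ *upper regular*. Let $\widehat W$ be the set of critical simplices and $\widehat W[p]=\{c\in K[p]\mid c\subseteq\widehat W\}$. A *frame* is a map assigning to each $\nu\in K^{(p)}$ an element of $\widehat W[p]$; it is extended linearly to chains. A *reference map* is a frame $\curlywedge$ with $\curlywedge(\nu)=\nu$ for $\nu$ critical, and $\curlywedge(\tau)=0$ and $\curlywedge(\partial(\tau))=0$ for $\tau$ upper regular. A *coreference map* is a frame $\curlyvee$ with $\curlyvee(\nu)=\nu$ for $\nu$ critical, and $\curlyvee(\sigma)=0$ and $\curlyvee(\delta(\sigma))=0$ for $\sigma$ lower regular. **Theorem.** Let $\overrightarrow W$ be a Morse sequence on $K$. Then $\overrightarrow W$ has a unique reference map $\curlywedge$ and a unique coreference map $\curlyvee$. On $\widehat W[p]$ put $\widehat\partial_p=\curlywedge_{p-1}\circ\partial_p$ and $\widehat\delta_p=\curlyvee_{p+1}\circ\delta_p$. Let $\widetilde\curlywedge_p,\widetilde\curlyvee_p:\widehat W[p]\to K[p]$ (the extension and coextension maps) be the linear maps with $\widetilde\curlywedge(\kappa)=\{\nu\in K\mid\kappa\in\curlyvee(\nu)\}$ and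 $\widetilde\curlyvee(\kappa)=\{\nu\in K\mid\kappa\in\curlywedge(\nu)\}$ for $\kappa$ critical, and let $\overline O[p]$ and $\underline O[p]$ be the images of $\widetilde\curlywedge_p$ and $\widetilde\curlyvee_p$. 1. $\partial$ maps $\overline O[p]$ into $\overline O[p-1]$ for all $p$; the extension complex $(\overline O[p],\partial_p)$ and the critical complex $(\widehat W[p],\widehat\partial_p)$ are chain complexes; and for every $p\in\mathbb Z$ the $\mathbb Z_2$-vector spaces $H_p(\overline O)$ and $H_p(\widehat W)$ are isomorphic. 2. $\delta$ maps $\underline O[p]$ into $\underline O[p+1]$ for all $p$; the coextension complex $(\underline O[p],\delta_p)$ and the cocritical complex $(\widehat W[p],\widehat\delta_p)$ are cochain complexes; and for every $p\in\mathbb Z$ the $\mathbb Z_2$-vector spaces $H^p(\underline O)$ and $H^p(\widehat W)$ are isomorphic. Here the homology (cohomology) in degree $p$ is the kernel of the operator leaving degree $p$ modulo the image of the operator arriving in degree $p$. -/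

import Mathlib

/-!
Simplicial complexes are Mathlib's `PreAbstractSimplicialComplex`: sets of nonempty finite sets,
closed under passing to nonempty subsets (the void complex is allowed, and vertices of `V` need not
belong to the complex).  All coefficients are in the field `ZMod 2`.
-/

section Sequences

variable {V : Type*}

/-- `ν` is a facet of `K`: a simplex of `K` that is maximal for inclusion. -/
def IsFacet (K : PreAbstractSimplicialComplex V) (ν : Finset V) : Prop :=
  ν ∈ K ∧ ∀ ρ ∈ K, ν ⊆ ρ → ρ = ν

/-- `(σ, τ)` is a free pair for `K`: `τ` is the only simplex of `K` that properly contains `σ`. -/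
def IsFreePair (K : PreAbstractSimplicialComplex V) (σ τ : Finset V) : Prop :=
  σ ∈ K ∧ τ ∈ K ∧ σ ⊂ τ ∧ ∀ ρ ∈ K, σ ⊂ ρ → ρ = τ

/-- `K` is the elementary filling of `L` by `ν`: `ν` is a facet of `K` and `L = K \ {ν}`. -/
def IsFillingBy (L K : PreAbstractSimplicialComplex V) (ν : Finset V) : Prop :=
  IsFacet K ν ∧ L.faces = K.faces \ {ν}

/-- `K` is the elementary expansion of `L` by `(σ, τ)`: `(σ, τ)` is a free pair for `K` and
`L = K \ {σ, τ}`. -/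
def IsExpansionBy (L K : PreAbstractSimplicialComplex V) (σ τ : Finset V) : Prop :=
  IsFreePair K σ τ ∧ L.faces = K.faces \ {σ, τ}

/-- A Morse sequence `∅ = K₀, …, K_k = K` on `K`: each term is an elementary filling or an
elementary expansion of the preceding one. -/
structure MorseSequence (K : PreAbstractSimplicialComplex V) where
  /-- the index `k` of the last complex -/
  length : ℕ
  /-- the complexes `K₀, …, K_k` -/
  stage : Fin (length + 1) → PreAbstractSimplicialComplex V
  stage_zero : (stage 0).faces = ∅
  stage_last : stage (Fin.last length) = K
  step : ∀ i : Fin length,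
    (∃ ν, IsFillingBy (stage i.castSucc) (stage i.succ) ν) ∨
      (∃ σ τ, IsExpansionBy (stage i.castSucc) (stage i.succ) σ τ)

namespace MorseSequence

variable {K : PreAbstractSimplicialComplex V} (W : MorseSequence K)

/-- `ν` is critical for `W`: it is added by one of the fillings of `W`. -/
def IsCritical (ν : Finset V) : Prop :=
  ∃ i : Fin W.length, IsFillingBy (W.stage i.castSucc) (W.stage i.succ) ν

/-- `(σ, τ)` is a regular pair for `W`: it is added by one of the expansions of `W`. -/
def IsRegularPair (σ τ : Finset V) : Prop :=
  ∃ i : Fin W.length, IsExpansionBy (W.stage i.castSucc) (W.stage i.succ) σ τ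

/-- `σ` is lower regular for `W`. -/
def IsLowerRegular (σ : Finset V) : Prop := ∃ τ, W.IsRegularPair σ τ

/-- `τ` is upper regular for `W`. -/
def IsUpperRegular (τ : Finset V) : Prop := ∃ σ, W.IsRegularPair σ τ

end MorseSequence

end Sequences

noncomputable section Chains

variable {V : Type*}

/-- Modulo 2 chains of `K` (of mixed dimension).  A chain is identified with the set of simplices
at which its coefficient is `1`, i.e. with its support. -/
abbrev Chains (K : PreAbstractSimplicialComplex V) : Type _ := K →₀ ZMod 2

/-- The space `K[p]` of `p`-chains: chains all of whose simplices have `p + 1` elements. -/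
def pChains (K : PreAbstractSimplicialComplex V) (p : ℤ) : Submodule (ZMod 2) (Chains K) :=
  Finsupp.supported (ZMod 2) (ZMod 2) {ν : K | ((ν : Finset V).card : ℤ) = p + 1}

/-- The chain of all simplices in a finite set of simplices. -/
def chainOf {K : PreAbstractSimplicialComplex V} (S : Finset K) : Chains K :=
  ∑ ν ∈ S, Finsupp.single ν 1

/-- The linear extension `c ↦ ∑_{ν ∈ c} Υ(ν)` of a map from simplices to chains. -/
abbrev linExt {K : PreAbstractSimplicialComplex V} (Υ : K → Chains K) :
    Chains K →ₗ[ZMod 2] Chains K :=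
  Finsupp.linearCombination (ZMod 2) Υ

variable [DecidableEq V] (K : PreAbstractSimplicialComplex V) [Fintype K]

/-- The boundary operator: `∂σ` is the set of the simplices of `K` contained in `σ` with one
element less. -/
def bdry : Chains K →ₗ[ZMod 2] Chains K :=
  linExt fun σ => chainOf (Finset.univ.filter fun τ : K =>
    (τ : Finset V) ⊂ (σ : Finset V) ∧ (τ : Finset V).card + 1 = (σ : Finset V).card)

/-- The coboundary operator: `δσ` is the set of the simplices of `K` containing `σ` with one
element more. -/
def cobdry : Chains K →ₗ[ZMod 2] Chains K :=
  linExt fun σ => chainOf (Finset.univ.filter fun τ : K =>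
    (σ : Finset V) ⊂ (τ : Finset V) ∧ (τ : Finset V).card = (σ : Finset V).card + 1)

end Chains

section Homology

variable {M : Type*} [AddCommGroup M] [Module (ZMod 2) M]

/-- `(C p, d)` is a chain complex: the subspaces `C p` of `M`, `p ∈ ℤ`, with the restrictions
`C p → C (p - 1)` of `d`, whose successive composites vanish. -/
def IsChainComplex (C : ℤ → Submodule (ZMod 2) M) (d : M →ₗ[ZMod 2] M) : Prop :=
  ∀ p : ℤ, ∀ c ∈ C p, d c ∈ C (p - 1) ∧ d (d c) = 0

/-- `(C p, d)` is a cochain complex: the subspaces `C p` of `M`, `p ∈ ℤ`, with the restrictions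
`C p → C (p + 1)` of `d`, whose successive composites vanish. -/
def IsCochainComplex (C : ℤ → Submodule (ZMod 2) M) (d : M →ₗ[ZMod 2] M) : Prop :=
  ∀ p : ℤ, ∀ c ∈ C p, d c ∈ C (p + 1) ∧ d (d c) = 0

/-- The cycles (or cocycles) of degree `p`: the kernel of `d` on `C p`. -/
abbrev cycles (C : ℤ → Submodule (ZMod 2) M) (d : M →ₗ[ZMod 2] M) (p : ℤ) :
    Submodule (ZMod 2) M :=
  C p ⊓ LinearMap.ker d

/-- The `p`-th homology space `Z_p / B_p`, where `B_p` is the image of `C (p + 1)` under `d`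
(contained in `Z_p` when `(C p, d)` is a chain complex). -/
abbrev HomologySpace (C : ℤ → Submodule (ZMod 2) M) (d : M →ₗ[ZMod 2] M) (p : ℤ) : Type _ :=
  cycles C d p ⧸ ((C (p + 1)).map d).comap (cycles C d p).subtype

/-- The `p`-th cohomology space `Z^p / B^p`, where `B^p` is the image of `C (p - 1)` under `d`
(contained in `Z^p` when `(C p, d)` is a cochain complex). -/
abbrev CohomologySpace (C : ℤ → Submodule (ZMod 2) M) (d : M →ₗ[ZMod 2] M) (p : ℤ) : Type _ :=
  cycles C d p ⧸ ((C (p - 1)).map d).comap (cycles C d p).subtype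

end Homology

noncomputable section Maps

namespace MorseSequence

variable {V : Type*} {K : PreAbstractSimplicialComplex V}

/-- The space `Ŵ[p]` of the `p`-chains made of critical simplices. -/
def criticalChains (W : MorseSequence K) (p : ℤ) : Submodule (ZMod 2) (Chains K) :=
  pChains K p ⊓ Finsupp.supported (ZMod 2) (ZMod 2) {ν : K | W.IsCritical (ν : Finset V)}

/-- A frame on `W`: each `p`-simplex of `K` is mapped to an element of `Ŵ[p]`. -/
def IsFrame (W : MorseSequence K) (Υ : K → Chains K) : Prop :=
  ∀ ν : K, Υ ν ∈ W.criticalChains (((ν : Finset V).card : ℤ) - 1)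

variable [DecidableEq V] [Fintype K]

/-- `r` is a reference map for `W`: a frame that is the identity on critical simplices and
satisfies `r(τ) = 0` and `r(∂τ) = 0` for every upper regular `τ`. -/
def IsReferenceMap (W : MorseSequence K) (r : K → Chains K) : Prop :=
  W.IsFrame r ∧
  (∀ ν : K, W.IsCritical (ν : Finset V) → r ν = Finsupp.single ν 1) ∧
  ∀ τ : K, W.IsUpperRegular (τ : Finset V) →
    r τ = 0 ∧ linExt r (bdry K (Finsupp.single τ 1)) = 0

/-- `s` is a coreference map for `W`: a frame that is the identity on critical simplices and
satisfies `s(σ) = 0` and `s(δσ) = 0` for every lower regular `σ`. -/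
def IsCoreferenceMap (W : MorseSequence K) (s : K → Chains K) : Prop :=
  W.IsFrame s ∧
  (∀ ν : K, W.IsCritical (ν : Finset V) → s ν = Finsupp.single ν 1) ∧
  ∀ σ : K, W.IsLowerRegular (σ : Finset V) →
    s σ = 0 ∧ linExt s (cobdry K (Finsupp.single σ 1)) = 0

/-- The boundary operator `c ↦ r(∂c)` of the critical complex, where `r` is the reference map. -/
def criticalBdry (r : K → Chains K) : Chains K →ₗ[ZMod 2] Chains K :=
  linExt r ∘ₗ bdry K

/-- The coboundary operator `c ↦ s(δc)` of the cocritical complex, where `s` is the coreference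
map. -/
def cocriticalCobdry (s : K → Chains K) : Chains K →ₗ[ZMod 2] Chains K :=
  linExt s ∘ₗ cobdry K

/-- The linear map with `κ ↦ {ν ∈ K | κ ∈ Υ(ν)}`.  On critical chains it is the extension map of
`W` when `Υ` is the coreference map, and the coextension map of `W` when `Υ` is the reference
map. -/
def extMap (Υ : K → Chains K) : Chains K →ₗ[ZMod 2] Chains K :=
  linExt fun κ => chainOf (Finset.univ.filter fun ν : K => κ ∈ (Υ ν).support)

/-- The image of `Ŵ[p]` under the linear map `κ ↦ {ν ∈ K | κ ∈ Υ(ν)}`. -/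
def extSpace (W : MorseSequence K) (Υ : K → Chains K) (p : ℤ) : Submodule (ZMod 2) (Chains K) :=
  (W.criticalChains p).map (extMap Υ)

end MorseSequence

end Maps

/-! The critical simplices, the upper regular simplices `τ` and the boundaries `∂τ` span all chains.
For lower regular `σ` with partner `τ`, the other facets of `τ` enter the sequence before `σ`, so
`σ` is obtained from `∂τ` by induction (`isAcyclicMatching_bdry`). There is one such generator per
simplex, so they form a basis. The reference map `r` is the projection that fixes the critical basis
vectors and kills the others, which gives existence and uniqueness. Dually, critical simplices,
lower regular `σ` and `δσ` span, by induction from the end of the sequence, which gives the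
coreference map `s`.

Checking on generators, `r ∂ r = r ∂` because `∂² = 0` (`linExt_comp_linExt`). Likewise `s δ s = s
δ`. The extension map `E` is the transpose of `s`, so transposing yields `E ∂ E = ∂ E`: the image of
`E` is stable under `∂` (`extMap_comp_extMap`). For a critical chain `x`, `E x - x` is made of upper
regular simplices, on which `r` and `r ∂` vanish. Hence `r E x = x` and `r ∂ E x = r ∂ x`
(`linExt_extMap`), and `r` and `E` are mutually inverse isomorphisms between the extension complex
and the critical complex.

The argument is carried out for an abstract matching and operator `d`, then applied to `∂` and, with
the pairs reversed, to `δ`. -/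

/-! ### Transport of homology along inverse maps -/

section HomologyTransport

variable {M : Type*} [AddCommGroup M] [Module (ZMod 2) M]

/-- The kernel of `d` on `A` modulo the image of `B` under `d`. -/
abbrev HomologyAt (A B : Submodule (ZMod 2) M) (d : M →ₗ[ZMod 2] M) : Type _ :=
  (A ⊓ LinearMap.ker d : Submodule (ZMod 2) M) ⧸
    (B.map d).comap (A ⊓ LinearMap.ker d).subtype

/-- Mutually inverse maps between `(A, d)` and `(A', d')`, compatible with the operators and with
the spaces `B`, `B'` of the preceding degree, induce an isomorphism of homology. -/
theorem nonempty_homology_equiv {A B A' B' : Submodule (ZMod 2) M} {d d' f g : M →ₗ[ZMod 2] M}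
    (hfA : ∀ x ∈ A, f x ∈ A') (hfB : ∀ x ∈ B, f x ∈ B')
    (hgA : ∀ x ∈ A', g x ∈ A) (hgB : ∀ x ∈ B', g x ∈ B)
    (hgf : ∀ x ∈ A, g (f x) = x) (hfg : ∀ x ∈ A', f (g x) = x)
    (hfdA : ∀ x ∈ A, f (d x) = d' (f x)) (hfdB : ∀ x ∈ B, f (d x) = d' (f x))
    (hgdA : ∀ x ∈ A', g (d' x) = d (g x)) (hgdB : ∀ x ∈ B', g (d' x) = d (g x)) :
    Nonempty (HomologyAt A B d ≃ₗ[ZMod 2] HomologyAt A' B' d') := by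
  have hf : ∀ x ∈ A ⊓ LinearMap.ker d, f x ∈ A' ⊓ LinearMap.ker d' := by
    rintro x ⟨hx, hdx⟩
    refine ⟨hfA x hx, ?_⟩
    rw [SetLike.mem_coe, LinearMap.mem_ker, ← hfdA x hx, LinearMap.mem_ker.1 hdx, map_zero]
  have hg : ∀ x ∈ A' ⊓ LinearMap.ker d', g x ∈ A ⊓ LinearMap.ker d := by
    rintro x ⟨hx, hdx⟩
    refine ⟨hgA x hx, ?_⟩
    rw [SetLike.mem_coe, LinearMap.mem_ker, ← hgdA x hx, LinearMap.mem_ker.1 hdx, map_zero]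
  let e : (A ⊓ LinearMap.ker d : Submodule (ZMod 2) M) ≃ₗ[ZMod 2]
      (A' ⊓ LinearMap.ker d' : Submodule (ZMod 2) M) :=
    LinearEquiv.ofLinearMap (f.restrict hf) (g.restrict hg)
      (by ext x; exact hfg x x.2.1) (by ext x; exact hgf x x.2.1)
  refine ⟨Submodule.Quotient.equiv _ _ e ?_⟩
  ext x
  rw [Submodule.mem_map]
  constructor
  · rintro ⟨y, ⟨b, hb, hby⟩, rfl⟩
    exact ⟨f b, hfB b hb, by rw [← hfdB b hb, hby]; rfl⟩
  · rintro ⟨b, hb, hbx⟩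
    refine ⟨e.symm x, ⟨g b, hgB b hb, ?_⟩, e.apply_symm_apply x⟩
    rw [← hgdB b hb, hbx]; rfl

end HomologyTransport

/-! ### Transposes for the standard bilinear form, and `∂² = 0` -/

section Transpose

open MorseSequence

variable {V : Type*} {K : PreAbstractSimplicialComplex V}

theorem chainOf_apply (S : Finset K) (ν : K) [Decidable (ν ∈ S)] :
    chainOf S ν = if ν ∈ S then 1 else 0 := by
  classical
  simp [chainOf, Finsupp.finsetSum_apply, Finsupp.single_apply]

theorem linExt_single (Υ : K → Chains K) (ν : K) : linExt Υ (Finsupp.single ν 1) = Υ ν := by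
  simp

variable [Fintype K]

theorem linExt_apply (Υ : K → Chains K) (x : Chains K) (ν : K) :
    linExt Υ x ν = ∑ κ, x κ * Υ κ ν := by
  simp [Finsupp.linearCombination_apply, Finsupp.sum_fintype, Finsupp.finsetSum_apply]

/-- The standard bilinear form on chains. -/
def chainDot (x y : Chains K) : ZMod 2 := ∑ ν, x ν * y ν

theorem chainDot_comm (x y : Chains K) : chainDot x y = chainDot y x := by
  simp [chainDot, mul_comm]

theorem chainDot_single (x : Chains K) (ν : K) : chainDot x (Finsupp.single ν 1) = x ν := by
  classical
  simp [chainDot, Finsupp.single_apply]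

theorem eq_of_chainDot {x y : Chains K} (h : ∀ z, chainDot x z = chainDot y z) : x = y := by
  ext ν
  rw [← chainDot_single x, h, chainDot_single]

/-- `d'` is the transpose of `d` for the standard bilinear form. -/
def IsTransposeOf (d' d : Chains K →ₗ[ZMod 2] Chains K) : Prop :=
  ∀ x y, chainDot (d x) y = chainDot x (d' y)

theorem IsTransposeOf.symm {d d' : Chains K →ₗ[ZMod 2] Chains K} (h : IsTransposeOf d' d) :
    IsTransposeOf d d' := fun x y => by
  rw [chainDot_comm, ← h, chainDot_comm]

theorem IsTransposeOf.comp_self {d d' : Chains K →ₗ[ZMod 2] Chains K} (h : IsTransposeOf d' d)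
    (hd : ∀ x, d (d x) = 0) (x : Chains K) : d' (d' x) = 0 := by
  refine eq_of_chainDot fun z => ?_
  rw [chainDot_comm, ← h, ← h, hd]
  simp [chainDot]

theorem isTransposeOf_linExt {Υ Υ' : K → Chains K} (h : ∀ ν κ, Υ ν κ = Υ' κ ν) :
    IsTransposeOf (linExt Υ') (linExt Υ) := by
  intro x y
  simp only [chainDot, linExt_apply, Finset.sum_mul, Finset.mul_sum]
  rw [Finset.sum_comm]
  refine Finset.sum_congr rfl fun ν _ => Finset.sum_congr rfl fun κ _ => ?_
  rw [h]
  ring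

variable [DecidableEq V]

theorem isTransposeOf_extMap (Υ : K → Chains K) : IsTransposeOf (extMap Υ) (linExt Υ) := by
  refine isTransposeOf_linExt fun ν κ => ?_
  rw [chainOf_apply]
  -- Modulo 2, a coefficient is the indicator of the support, so the set defining `extMap` is a
  -- column of the transposed matrix.
  have h : ∀ a : ZMod 2, a = if a ≠ 0 then 1 else 0 := by decide
  simpa using h (Υ ν κ)

theorem extMap_apply (Υ : K → Chains K) (x : Chains K) (ν : K) :
    extMap Υ x ν = chainDot (Υ ν) x := by
  rw [← chainDot_single (extMap Υ x), chainDot_comm, ← isTransposeOf_extMap, linExt_single]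

theorem isTransposeOf_cobdry : IsTransposeOf (cobdry K) (bdry K) := by
  refine isTransposeOf_linExt fun ν κ => ?_
  simp only [chainOf_apply, Finset.mem_filter, Finset.mem_univ, true_and]
  simp only [eq_comm]

/-- The simplices strictly between `ρ` and `σ`, when these differ by two vertices, are exchanged
without fixed point by `τ ↦ ρ ∪ (σ \ τ)`, so their number is even. -/
theorem bdry_bdry (x : Chains K) : bdry K (bdry K x) = 0 := by
  suffices h : bdry K ∘ₗ bdry K = 0 from LinearMap.congr_fun h x
  ext σ ρ
  simp only [LinearMap.comp_apply, Finsupp.lsingle_apply, LinearMap.zero_apply,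
    Finsupp.coe_zero, Pi.zero_apply, bdry, linExt_single]
  rw [linExt_apply]
  simp only [chainOf_apply, Finset.mem_filter, Finset.mem_univ, true_and, ← ite_and, mul_ite,
    mul_one, mul_zero]
  rw [← Finset.sum_filter]
  have hK : ∀ τ : K, (ρ : Finset V) ∪ ((σ : Finset V) \ τ) ⊆ σ →
      (ρ : Finset V) ∪ ((σ : Finset V) \ τ) ∈ K := fun τ h =>
    (K.isRelLowerSet_faces σ.2).2 h ((K.isRelLowerSet_faces ρ.2).1.mono Finset.subset_union_left)
  have hsub : ∀ τ ∈ Finset.univ.filter fun τ : K => ((ρ : Finset V) ⊂ τ ∧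
      (ρ : Finset V).card + 1 = (τ : Finset V).card) ∧ (τ : Finset V) ⊂ σ ∧
      (τ : Finset V).card + 1 = (σ : Finset V).card,
      (ρ : Finset V) ∪ ((σ : Finset V) \ τ) ⊆ σ := by
    intro τ h
    simp only [Finset.mem_filter, Finset.mem_univ, true_and] at h
    exact Finset.union_subset (h.1.1.1.trans h.2.1.1) Finset.sdiff_subset
  refine Finset.sum_involution (fun τ h => ⟨(ρ : Finset V) ∪ ((σ : Finset V) \ τ),
    hK τ (hsub τ h)⟩) ?_ ?_ ?_ ?_
  · intros; decide
  · intro τ h _ heq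
    simp only [Finset.mem_filter, Finset.mem_univ, true_and] at h
    obtain ⟨v, hv, hv'⟩ := Finset.exists_of_ssubset h.1.1
    have := congrArg (fun τ : K => v ∈ (τ : Finset V)) heq
    simp [hv, hv'] at this
  · intro τ h
    have hs := hsub τ h
    simp only [Finset.mem_filter, Finset.mem_univ, true_and] at h ⊢
    obtain ⟨⟨h1, h2⟩, h3, h4⟩ := h
    have hc : ((ρ : Finset V) ∪ ((σ : Finset V) \ τ)).card = (ρ : Finset V).card + 1 := by
      rw [Finset.card_union_of_disjoint (Finset.disjoint_sdiff.mono_left h1.1),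
        Finset.card_sdiff_of_subset h3.1]
      omega
    refine ⟨⟨?_, hc.symm⟩, ?_, by omega⟩
    · refine Finset.ssubset_iff_subset_ne.2 ⟨Finset.subset_union_left, fun h => ?_⟩
      rw [← h] at hc
      omega
    · refine Finset.ssubset_iff_subset_ne.2 ⟨hs, fun h => ?_⟩
      rw [h] at hc
      omega
  · intro τ h
    simp only [Finset.mem_filter, Finset.mem_univ, true_and] at h
    have h1 := h.1.1.1
    have h3 := h.2.1.1
    ext v
    have h1v := @h1 v
    have h3v := @h3 v
    simp only [Finset.mem_union, Finset.mem_sdiff]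
    tauto

end Transpose

/-! ### Acyclic matchings, their frames and their extension complexes -/

namespace MorseSequence

section Matchings

variable {V : Type*} {K : PreAbstractSimplicialComplex V}

/-- The chains of simplices with `n` elements given by a critical simplex, by a simplex `τ` matched
by `pair σ τ`, or by the image under `d` of such a `τ`. -/
def matchingGenerators (W : MorseSequence K) (d : Chains K →ₗ[ZMod 2] Chains K)
    (pair : K → K → Prop) (n : ℕ) : Set (Chains K) :=
  {x | (∃ ν : K, (ν : Finset V).card = n ∧ (W.IsCritical ν ∨ ∃ σ, pair σ ν) ∧
      x = Finsupp.single ν 1) ∨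
    ∃ σ τ : K, pair σ τ ∧ (σ : Finset V).card = n ∧ x = d (Finsupp.single τ 1)}

/-- A partition of the simplices into critical simplices and pairs `(σ, τ)`, which is acyclic with
respect to `d`: the critical simplices, the `τ` and the `d τ` span all chains. -/
structure IsAcyclicMatching (W : MorseSequence K) (d : Chains K →ₗ[ZMod 2] Chains K)
    (pair : K → K → Prop) : Prop where
  right_unique : ∀ {σ τ τ' : K}, pair σ τ → pair σ τ' → τ = τ'
  not_critical_left : ∀ {σ τ : K}, pair σ τ → ¬ W.IsCritical σ
  not_critical_right : ∀ {σ τ : K}, pair σ τ → ¬ W.IsCritical τ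
  not_left_of_right : ∀ {σ τ ρ : K}, pair σ τ → ¬ pair τ ρ
  exhaustive : ∀ ν : K, W.IsCritical ν ∨ (∃ τ, pair ν τ) ∨ ∃ σ, pair σ ν
  single_mem_span : ∀ ν : K, Finsupp.single ν 1 ∈
    Submodule.span (ZMod 2) (W.matchingGenerators d pair (ν : Finset V).card)

/-- A frame that is the identity on critical simplices and such that `τ` and `d τ` are mapped to
zero for all matched pairs `(σ, τ)`. -/
def IsMatchingFrame (W : MorseSequence K) (d : Chains K →ₗ[ZMod 2] Chains K)
    (pair : K → K → Prop) (r : K → Chains K) : Prop :=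
  W.IsFrame r ∧ (∀ ν : K, W.IsCritical ν → r ν = Finsupp.single ν 1) ∧
    ∀ σ τ : K, pair σ τ → r τ = 0 ∧ linExt r (d (Finsupp.single τ 1)) = 0

variable {W : MorseSequence K} {d d' : Chains K →ₗ[ZMod 2] Chains K} {pair : K → K → Prop}
  {r s : K → Chains K}

theorem mem_pChains {x : Chains K} {p : ℤ} :
    x ∈ pChains K p ↔ ∀ ν : K, x ν ≠ 0 → ((ν : Finset V).card : ℤ) = p + 1 := by
  simp [pChains, Finsupp.mem_supported, Set.subset_def]

theorem mem_criticalChains {x : Chains K} {p : ℤ} :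
    x ∈ W.criticalChains p ↔
      ∀ ν : K, x ν ≠ 0 → ((ν : Finset V).card : ℤ) = p + 1 ∧ W.IsCritical ν := by
  simp only [criticalChains, pChains, Submodule.mem_inf, Finsupp.mem_supported, Set.subset_def]
  simp only [Finset.mem_coe, Finsupp.mem_support_iff, Set.mem_ofPred_eq]
  grind

theorem single_mem_criticalChains {ν : K} (h : W.IsCritical ν) :
    Finsupp.single ν 1 ∈ W.criticalChains (((ν : Finset V).card : ℤ) - 1) := by
  classical
  rw [mem_criticalChains]
  intro μ hμ
  rw [Finsupp.single_apply] at hμ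
  split_ifs at hμ with h'
  · subst h'
    exact ⟨by ring, h⟩
  · exact absurd rfl hμ

namespace IsAcyclicMatching

/-- The generators span, so operators may be compared on them alone. Both the uniqueness of frames
and the identity `r d r = r d` reduce to this. -/
theorem linearMap_ext (h : W.IsAcyclicMatching d pair) {f g : Chains K →ₗ[ZMod 2] Chains K}
    (hcrit : ∀ ν : K, W.IsCritical ν → f (Finsupp.single ν 1) = g (Finsupp.single ν 1))
    (hpair : ∀ σ τ : K, pair σ τ → f (Finsupp.single τ 1) = g (Finsupp.single τ 1))
    (hd : ∀ σ τ : K, pair σ τ → f (d (Finsupp.single τ 1)) = g (d (Finsupp.single τ 1))) :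
    f = g := by
  refine Finsupp.lhom_ext' fun ν => LinearMap.ext_ring ?_
  refine LinearMap.eqOn_span (s := W.matchingGenerators d pair (ν : Finset V).card) ?_
    (h.single_mem_span ν)
  rintro x (⟨μ, -, hμ | ⟨σ, hσ⟩, rfl⟩ | ⟨σ, τ, hστ, -, rfl⟩)
  · exact hcrit μ hμ
  · exact hpair σ μ hσ
  · exact hd σ τ hστ

theorem frame_unique (h : W.IsAcyclicMatching d pair) (hr : W.IsMatchingFrame d pair r)
    (hs : W.IsMatchingFrame d pair s) : r = s := by
  have : linExt r = linExt s := by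
    refine h.linearMap_ext (fun ν hν => ?_) (fun σ τ hστ => ?_) fun σ τ hστ => ?_
    · rw [linExt_single, linExt_single, hr.2.1 ν hν, hs.2.1 ν hν]
    · rw [linExt_single, linExt_single, (hr.2.2 σ τ hστ).1, (hs.2.2 σ τ hστ).1]
    · rw [(hr.2.2 σ τ hστ).2, (hs.2.2 σ τ hστ).2]
  ext1 ν
  rw [← linExt_single r, this, linExt_single]

theorem exists_frame [Fintype K] (h : W.IsAcyclicMatching d pair) :
    ∃ r, W.IsMatchingFrame d pair r := by
  classical
  -- The generators, indexed by the simplices themselves: the left member `σ` of a pair carries `d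
  -- τ`, every other simplex carries itself.
  let b : K → Chains K := fun ν =>
    if h : ∃ τ, pair ν τ then d (Finsupp.single h.choose 1) else Finsupp.single ν 1
  have b_left : ∀ {σ τ}, pair σ τ → b σ = d (Finsupp.single τ 1) := by
    intro σ τ hστ
    have h' : ∃ τ, pair σ τ := ⟨τ, hστ⟩
    simp only [b, dif_pos h', h.right_unique h'.choose_spec hστ]
  have b_right : ∀ {σ τ}, pair σ τ → b τ = Finsupp.single τ 1 := by
    intro σ τ hστ
    exact dif_neg fun ⟨ρ, hρ⟩ => h.not_left_of_right hστ hρ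
  have b_crit : ∀ {ν : K}, W.IsCritical ν → b ν = Finsupp.single ν 1 := by
    intro ν hν
    exact dif_neg fun ⟨ρ, hρ⟩ => h.not_critical_left hρ hν
  have hspan : ⊤ ≤ Submodule.span (ZMod 2) (Set.range b) := by
    have hle : ∀ ν : K, Finsupp.single ν 1 ∈ Submodule.span (ZMod 2) (Set.range b) := by
      intro ν
      refine Submodule.span_mono ?_ (h.single_mem_span ν)
      rintro x (⟨μ, -, hμ | ⟨σ, hσ⟩, rfl⟩ | ⟨σ, τ, hστ, -, rfl⟩)
      · exact ⟨μ, b_crit hμ⟩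
      · exact ⟨μ, b_right hσ⟩
      · exact ⟨σ, b_left hστ⟩
    intro x _
    induction x using Finsupp.induction_linear with
    | zero => exact Submodule.zero_mem _
    | add x y hx hy => exact Submodule.add_mem _ (hx trivial) (hy trivial)
    | single ν a =>
      rw [← mul_one a, ← smul_eq_mul, ← Finsupp.smul_single]
      exact Submodule.smul_mem _ _ (hle ν)
  -- A spanning family with as many members as the dimension is a basis, so values on it can be
  -- prescribed freely.
  let B := basisOfTopLeSpanOfCardEqFinrank b hspan (by simp)
  let R : Chains K →ₗ[ZMod 2] Chains K :=
    B.constr (ZMod 2) fun ν => if W.IsCritical ν then Finsupp.single ν 1 else 0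
  have hR : ∀ ν, R (b ν) = if W.IsCritical ν then Finsupp.single ν 1 else 0 := by
    intro ν
    have := B.constr_basis (ZMod 2)
      (fun ν : K => if W.IsCritical ν then (Finsupp.single ν 1 : Chains K) else 0) ν
    rwa [show B ν = b ν by simp [B]] at this
  have hlin : linExt (fun ν => R (Finsupp.single ν 1)) = R := by
    ext1 ν
    ext1
    simp
  refine ⟨fun ν => R (Finsupp.single ν 1), fun ν => ?_, fun ν hν => ?_, fun σ τ hστ => ⟨?_, ?_⟩⟩
  -- The frame condition on degrees holds because `ν` is spanned by the generators attached to its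
  -- own cardinality, each of which `R` sends to a critical simplex of that cardinality or to zero.
  · have : Submodule.span (ZMod 2) (W.matchingGenerators d pair (ν : Finset V).card) ≤
        (W.criticalChains (((ν : Finset V).card : ℤ) - 1)).comap R := by
      rw [Submodule.span_le]
      rintro x (⟨μ, hc, hμ | ⟨σ, hσ⟩, rfl⟩ | ⟨σ, τ, hστ, -, rfl⟩)
      · rw [SetLike.mem_coe, Submodule.mem_comap, ← b_crit hμ, hR, if_pos hμ, ← hc]
        exact single_mem_criticalChains hμ
      · rw [SetLike.mem_coe, Submodule.mem_comap, ← b_right hσ, hR,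
          if_neg (h.not_critical_right hσ)]
        exact Submodule.zero_mem _
      · rw [SetLike.mem_coe, Submodule.mem_comap, ← b_left hστ, hR,
          if_neg (h.not_critical_left hστ)]
        exact Submodule.zero_mem _
    exact this (h.single_mem_span ν)
  · simp only
    rw [← b_crit hν, hR, if_pos hν, b_crit hν]
  · simp only
    rw [← b_right hστ, hR, if_neg (h.not_critical_right hστ)]
  · rw [hlin, ← b_left hστ, hR, if_neg (h.not_critical_left hστ)]

/-- On a critical simplex `r` is the identity, on `τ` both sides vanish, and on `d τ` both vanish
because `d² = 0`. This makes `r` a morphism of complexes onto the critical complex. -/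
theorem linExt_comp_linExt (h : W.IsAcyclicMatching d pair) (hr : W.IsMatchingFrame d pair r)
    (hd : ∀ x, d (d x) = 0) (x : Chains K) :
    linExt r (d (linExt r x)) = linExt r (d x) := by
  suffices linExt r ∘ₗ d ∘ₗ linExt r = linExt r ∘ₗ d from LinearMap.congr_fun this x
  refine h.linearMap_ext (fun ν hν => ?_) (fun σ τ hστ => ?_) fun σ τ hστ => ?_ <;>
    simp only [LinearMap.comp_apply]
  · rw [linExt_single, hr.2.1 ν hν]
  · rw [linExt_single, (hr.2.2 σ τ hστ).1, (hr.2.2 σ τ hστ).2, map_zero, map_zero]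
  · rw [(hr.2.2 σ τ hστ).2, hd, map_zero, map_zero]

end IsAcyclicMatching

namespace IsMatchingFrame

theorem eq_zero_of_not_critical (hr : W.IsMatchingFrame d pair r) {ν κ : K}
    (h : ¬ W.IsCritical κ) : r ν κ = 0 := by
  by_contra h'
  exact h (mem_criticalChains.1 (hr.1 ν) κ h').2

theorem linExt_eq_self (hr : W.IsMatchingFrame d pair r) {x : Chains K} {p : ℤ}
    (hx : x ∈ W.criticalChains p) : linExt r x = x := by
  conv_rhs => rw [← Finsupp.sum_single x]
  rw [Finsupp.linearCombination_apply]
  refine Finset.sum_congr rfl fun ν hν => ?_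
  have := mem_criticalChains.1 hx ν (Finsupp.mem_support_iff.1 hν)
  simp only
  rw [hr.2.1 ν this.2, Finsupp.smul_single, smul_eq_mul, mul_one]

theorem linExt_mem (hr : W.IsMatchingFrame d pair r) {x : Chains K} {p : ℤ}
    (hx : x ∈ pChains K p) : linExt r x ∈ W.criticalChains p := by
  rw [Finsupp.linearCombination_apply]
  refine Submodule.sum_mem _ fun ν hν => Submodule.smul_mem _ _ ?_
  have := mem_pChains.1 hx ν (Finsupp.mem_support_iff.1 hν)
  simpa [this] using hr.1 ν

theorem comp_eq_zero (hr : W.IsMatchingFrame d pair r) {x : Chains K}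
    (hx : ∀ ν : K, x ν ≠ 0 → ∃ σ, pair σ ν) : linExt r x = 0 ∧ linExt r (d x) = 0 := by
  rw [← Finsupp.sum_single x, Finsupp.sum]
  simp only [map_sum]
  refine ⟨Finset.sum_eq_zero fun ν hν => ?_, Finset.sum_eq_zero fun ν hν => ?_⟩ <;>
    obtain ⟨σ, hσ⟩ := hx ν (Finsupp.mem_support_iff.1 hν) <;>
    rw [← mul_one (x ν), ← smul_eq_mul, ← Finsupp.smul_single] <;>
    simp only [map_smul]
  · rw [linExt_single, (hr.2.2 σ ν hσ).1, smul_zero]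
  · rw [(hr.2.2 σ ν hσ).2, smul_zero]

variable [Fintype K] [DecidableEq V]

theorem extMap_mem (hs : W.IsMatchingFrame d pair s) {x : Chains K} {p : ℤ}
    (hx : x ∈ pChains K p) : extMap s x ∈ pChains K p := by
  rw [mem_pChains]
  intro ν hν
  rw [extMap_apply, chainDot] at hν
  obtain ⟨κ, -, hκ⟩ := Finset.exists_ne_zero_of_sum_ne_zero hν
  have h1 := (mem_criticalChains.1 (hs.1 ν) κ (left_ne_zero_of_mul hκ)).1
  have h2 := mem_pChains.1 hx κ (right_ne_zero_of_mul hκ)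
  linarith

/-- The extension of a chain only depends on its critical part. -/
theorem extMap_mem_extSpace (hs : W.IsMatchingFrame d pair s) {x : Chains K} {p : ℤ}
    (hx : x ∈ pChains K p) : extMap s x ∈ W.extSpace s p := by
  classical
  refine ⟨x.filter fun κ : K => W.IsCritical κ, ?_, ?_⟩
  · rw [SetLike.mem_coe, mem_criticalChains]
    intro ν hν
    rw [Finsupp.filter_apply] at hν
    split_ifs at hν with h
    · exact ⟨mem_pChains.1 hx ν hν, h⟩
    · exact absurd rfl hν
  · ext ν
    rw [extMap_apply, extMap_apply]
    refine Finset.sum_congr rfl fun κ _ => ?_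
    rw [Finsupp.filter_apply]
    split_ifs with h
    · rfl
    · rw [hs.eq_zero_of_not_critical h, zero_mul, zero_mul]

end IsMatchingFrame

variable [Fintype K] [DecidableEq V]

/-- This is the transpose of `linExt_comp_linExt` for `d'`. It shows that `d` preserves the image of
the extension map. -/
theorem IsAcyclicMatching.extMap_comp_extMap (h : W.IsAcyclicMatching d' pair)
    (hs : W.IsMatchingFrame d' pair s) (ht : IsTransposeOf d' d) (hd : ∀ x, d (d x) = 0)
    (x : Chains K) : extMap s (d (extMap s x)) = d (extMap s x) := by
  refine eq_of_chainDot fun z => ?_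
  rw [chainDot_comm, chainDot_comm _ z, ← isTransposeOf_extMap, ← ht.symm, ← isTransposeOf_extMap,
    ← ht.symm, ← isTransposeOf_extMap, h.linExt_comp_linExt hs (ht.comp_self hd)]

/-- The extension of a critical chain differs from it by simplices `τ` of matched pairs. -/
theorem IsAcyclicMatching.extMap_sub_apply_ne_zero (h : W.IsAcyclicMatching d pair)
    (hs : W.IsMatchingFrame d' (flip pair) s) {x : Chains K} {p : ℤ}
    (hx : x ∈ W.criticalChains p) (ν : K) (hν : (extMap s x - x) ν ≠ 0) : ∃ σ, pair σ ν := by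
  rw [Finsupp.sub_apply, extMap_apply] at hν
  rcases h.exhaustive ν with hc | ⟨τ, hτ⟩ | h'
  -- On critical `ν` the two chains agree; on the left member of a pair both vanish, as `s` kills it
  -- and `x` is critical.
  · rw [hs.2.1 ν hc, chainDot_comm, chainDot_single, sub_self] at hν
    exact absurd rfl hν
  · have : x ν = 0 := by
      by_contra h0
      exact h.not_critical_left hτ (mem_criticalChains.1 hx ν h0).2
    rw [(hs.2.2 τ ν hτ).1, this] at hν
    simp [chainDot] at hν
  · exact h'

theorem IsAcyclicMatching.linExt_extMap (h : W.IsAcyclicMatching d pair)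
    (hr : W.IsMatchingFrame d pair r) (hs : W.IsMatchingFrame d' (flip pair) s)
    {x : Chains K} {p : ℤ} (hx : x ∈ W.criticalChains p) :
    linExt r (extMap s x) = x ∧ linExt r (d (extMap s x)) = linExt r (d x) := by
  have := hr.comp_eq_zero (h.extMap_sub_apply_ne_zero hs hx)
  rw [map_sub, map_sub, map_sub, sub_eq_zero, sub_eq_zero, hr.linExt_eq_self hx] at this
  exact this

/-- The extension complex of a matching is isomorphic, by the extension map, to its critical
complex. -/
theorem IsAcyclicMatching.extSpace_homology (h : W.IsAcyclicMatching d pair)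
    (h' : W.IsAcyclicMatching d' (flip pair)) (ht : IsTransposeOf d' d)
    (hd : ∀ x, d (d x) = 0) {e : ℤ} (hdeg : ∀ p, ∀ c ∈ pChains K p, d c ∈ pChains K (p + e))
    (hr : W.IsMatchingFrame d pair r) (hs : W.IsMatchingFrame d' (flip pair) s) :
    (∀ p, ∀ c ∈ W.extSpace s p, d c ∈ W.extSpace s (p + e) ∧ d (d c) = 0) ∧
    (∀ p, ∀ c ∈ W.criticalChains p, (linExt r ∘ₗ d) c ∈ W.criticalChains (p + e) ∧
      (linExt r ∘ₗ d) ((linExt r ∘ₗ d) c) = 0) ∧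
    ∀ p q, Nonempty
      (HomologyAt (W.extSpace s p) (W.extSpace s q) d ≃ₗ[ZMod 2]
        HomologyAt (W.criticalChains p) (W.criticalChains q) (linExt r ∘ₗ d)) := by
  have hO : ∀ p, ∀ c ∈ W.extSpace s p, d c ∈ W.extSpace s (p + e) := by
    rintro p _ ⟨x, hx, rfl⟩
    rw [← h'.extMap_comp_extMap hs ht hd]
    exact hs.extMap_mem_extSpace (hdeg _ _ (hs.extMap_mem hx.1))
  have hf : ∀ p, ∀ c ∈ W.extSpace s p, linExt r c ∈ W.criticalChains p := by
    rintro p _ ⟨x, hx, rfl⟩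
    rw [(h.linExt_extMap hr hs hx).1]
    exact hx
  have hgf : ∀ p, ∀ c ∈ W.extSpace s p, extMap s (linExt r c) = c := by
    rintro p _ ⟨x, hx, rfl⟩
    rw [(h.linExt_extMap hr hs hx).1]
  have hg : ∀ p, ∀ x ∈ W.criticalChains p, extMap s x ∈ W.extSpace s p :=
    fun p x hx => ⟨x, hx, rfl⟩
  have hfd : ∀ p, ∀ c ∈ W.extSpace s p, linExt r (d c) = (linExt r ∘ₗ d) (linExt r c) :=
    fun p c _ => (h.linExt_comp_linExt hr hd c).symm
  have hgd : ∀ p, ∀ x ∈ W.criticalChains p,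
      extMap s ((linExt r ∘ₗ d) x) = d (extMap s x) := by
    intro p x hx
    -- After replacing `r d x` by `r d (extMap s x)`, the chain `d (extMap s x)` lies in the
    -- extension space, where `extMap s` inverts `r`.
    rw [LinearMap.comp_apply, ← (h.linExt_extMap hr hs hx).2]
    exact hgf _ _ (hO p _ (hg p x hx))
  refine ⟨fun p c hc => ⟨hO p c hc, hd c⟩, fun p c hc => ⟨?_, ?_⟩, fun p q => ?_⟩
  · exact hr.linExt_mem (hdeg p c hc.1)
  · simp only [LinearMap.comp_apply]
    rw [h.linExt_comp_linExt hr hd, hd, map_zero]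
  · exact nonempty_homology_equiv (hf p) (hf q) (hg p) (hg q) (hgf p)
      (fun x hx => (h.linExt_extMap hr hs hx).1) (hfd p) (hfd q) (hgd p) (hgd q)

end Matchings

end MorseSequence

/-! ### Simplices added by one filling or expansion -/

section Steps

variable {V : Type*} {L K : PreAbstractSimplicialComplex V} {ν σ τ : Finset V}

theorem IsFillingBy.mem_sdiff_iff (h : IsFillingBy L K ν) {μ : Finset V} :
    μ ∈ K ∧ μ ∉ L ↔ μ = ν := by
  have h1 : μ ∈ L ↔ μ ∈ K ∧ μ ≠ ν := by
    change μ ∈ L.faces ↔ _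
    rw [h.2]
    rfl
  have h2 := h.1.1
  rw [h1]
  constructor
  · tauto
  · rintro rfl
    tauto

theorem IsExpansionBy.mem_sdiff_iff (h : IsExpansionBy L K σ τ) {μ : Finset V} :
    μ ∈ K ∧ μ ∉ L ↔ μ = σ ∨ μ = τ := by
  have h1 : μ ∈ L ↔ μ ∈ K ∧ ¬ (μ = σ ∨ μ = τ) := by
    change μ ∈ L.faces ↔ _
    rw [h.2]
    rfl
  have h2 := h.1.1
  have h3 := h.1.2.1
  rw [h1]
  constructor
  · tauto
  · rintro (rfl | rfl) <;> tauto

/-- Adding to `σ` a single vertex of `τ \ σ` already gives a simplex properly containing `σ`, which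
must then be `τ`. -/
theorem IsFreePair.card_eq [DecidableEq V] (h : IsFreePair K σ τ) : τ.card = σ.card + 1 := by
  obtain ⟨hσ, hτ, hlt, huniq⟩ := h
  obtain ⟨v, hv, hvσ⟩ := Finset.exists_of_ssubset hlt
  rw [← huniq (insert v σ) ((K.isRelLowerSet_faces hτ).2 (Finset.insert_subset hv hlt.1)
    (Finset.insert_nonempty _ _)) (Finset.ssubset_insert hvσ), Finset.card_insert_of_notMem hvσ]

end Steps

/-! ### Degrees of the boundary and coboundary -/

section Degree

open MorseSequence

variable {V : Type*} {K : PreAbstractSimplicialComplex V}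

theorem linExt_mem_pChains {Υ : K → Chains K} {e : ℤ}
    (h : ∀ ν μ : K, Υ ν μ ≠ 0 → ((μ : Finset V).card : ℤ) = (ν : Finset V).card + e)
    {p : ℤ} {c : Chains K} (hc : c ∈ pChains K p) : linExt Υ c ∈ pChains K (p + e) := by
  rw [Finsupp.linearCombination_apply]
  refine Submodule.sum_mem _ fun ν hν => Submodule.smul_mem _ _ (mem_pChains.2 fun μ hμ => ?_)
  rw [h ν μ hμ, mem_pChains.1 hc ν (Finsupp.mem_support_iff.1 hν)]
  ring

theorem single_mem_of_chainOf_mem {S : Finset K} {σ : K} {P : Submodule (ZMod 2) (Chains K)}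
    (hS : chainOf S ∈ P) (hσ : σ ∈ S) (h : ∀ ρ ∈ S, ρ ≠ σ → Finsupp.single ρ 1 ∈ P) :
    Finsupp.single σ 1 ∈ P := by
  classical
  rw [chainOf, ← Finset.add_sum_erase _ _ hσ] at hS
  refine (Submodule.add_mem_iff_left _ (Submodule.sum_mem _ fun ρ hρ => ?_)).1 hS
  exact h ρ (Finset.mem_of_mem_erase hρ) (Finset.ne_of_mem_erase hρ)

variable [DecidableEq V] [Fintype K]

theorem bdry_mem_pChains {p : ℤ} {c : Chains K} (hc : c ∈ pChains K p) :
    bdry K c ∈ pChains K (p + -1) := by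
  refine linExt_mem_pChains (fun ν μ h => ?_) hc
  simp only [chainOf_apply, Finset.mem_filter, Finset.mem_univ, true_and, ne_eq,
    ite_eq_right_iff, Classical.not_imp] at h
  omega

theorem cobdry_mem_pChains {p : ℤ} {c : Chains K} (hc : c ∈ pChains K p) :
    cobdry K c ∈ pChains K (p + 1) := by
  refine linExt_mem_pChains (fun ν μ h => ?_) hc
  simp only [chainOf_apply, Finset.mem_filter, Finset.mem_univ, true_and, ne_eq,
    ite_eq_right_iff, Classical.not_imp] at h
  omega

end Degree

/-! ### The stages of a Morse sequence and its two acyclic matchings -/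

namespace MorseSequence

section Stages

variable {V : Type*} {K : PreAbstractSimplicialComplex V} (W : MorseSequence K)

theorem monotone_stage : Monotone W.stage := by
  rw [Fin.monotone_iff_le_succ]
  intro i ν hν
  rcases W.step i with ⟨μ, h⟩ | ⟨σ, τ, h⟩
  all_goals
    change ν ∈ (W.stage i.castSucc).faces at hν
    rw [h.2] at hν
    exact hν.1

theorem mem_of_mem_stage {i : Fin (W.length + 1)} {ν : Finset V} (h : ν ∈ W.stage i) : ν ∈ K := by
  have := W.monotone_stage (Fin.le_last i) h
  rwa [W.stage_last] at this

/-- Stages increase, so a simplex enters only once. Any two steps adding a common simplex therefore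
coincide, from which the disjointness and uniqueness of regular pairs follow. -/
theorem eq_of_mem_sdiff {i j : Fin W.length} {ν : Finset V}
    (hi : ν ∈ W.stage i.succ ∧ ν ∉ W.stage i.castSucc)
    (hj : ν ∈ W.stage j.succ ∧ ν ∉ W.stage j.castSucc) : i = j := by
  rcases lt_trichotomy i j with h | h | h
  · exact absurd (W.monotone_stage (Fin.le_def.2 (Nat.succ_le_of_lt h)) hi.1)
      hj.2
  · exact h
  · exact absurd (W.monotone_stage (Fin.le_def.2 (Nat.succ_le_of_lt h)) hj.1)
      hi.2

variable {W}

theorem IsRegularPair.mem_left {σ τ : Finset V} (h : W.IsRegularPair σ τ) : σ ∈ K :=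
  let ⟨_, hi⟩ := h
  W.mem_of_mem_stage hi.1.1

theorem IsRegularPair.mem_right {σ τ : Finset V} (h : W.IsRegularPair σ τ) : τ ∈ K :=
  let ⟨_, hi⟩ := h
  W.mem_of_mem_stage hi.1.2.1

theorem IsRegularPair.right_unique {σ τ τ' : Finset V} (h : W.IsRegularPair σ τ)
    (h' : W.IsRegularPair σ τ') : τ = τ' := by
  obtain ⟨i, hi⟩ := h
  obtain ⟨j, hj⟩ := h'
  obtain rfl := W.eq_of_mem_sdiff (hi.mem_sdiff_iff.2 (.inl rfl)) (hj.mem_sdiff_iff.2 (.inl rfl))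
  exact hj.1.2.2.2 τ hi.1.2.1 hi.1.2.2.1

theorem IsRegularPair.left_unique {σ σ' τ : Finset V} (h : W.IsRegularPair σ τ)
    (h' : W.IsRegularPair σ' τ) : σ = σ' := by
  obtain ⟨i, hi⟩ := h
  obtain ⟨j, hj⟩ := h'
  obtain rfl := W.eq_of_mem_sdiff (hi.mem_sdiff_iff.2 (.inr rfl)) (hj.mem_sdiff_iff.2 (.inr rfl))
  exact (hj.mem_sdiff_iff.1 (hi.mem_sdiff_iff.2 (.inl rfl))).resolve_right hi.1.2.2.1.ne

theorem IsRegularPair.not_critical_left {σ τ : Finset V} (h : W.IsRegularPair σ τ) :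
    ¬ W.IsCritical σ := by
  rintro ⟨j, hj⟩
  obtain ⟨i, hi⟩ := h
  obtain rfl := W.eq_of_mem_sdiff (hi.mem_sdiff_iff.2 (.inl rfl)) (hj.mem_sdiff_iff.2 rfl)
  exact hi.1.2.2.1.ne' (hj.mem_sdiff_iff.1 (hi.mem_sdiff_iff.2 (.inr rfl)))

theorem IsRegularPair.not_critical_right {σ τ : Finset V} (h : W.IsRegularPair σ τ) :
    ¬ W.IsCritical τ := by
  rintro ⟨j, hj⟩
  obtain ⟨i, hi⟩ := h
  obtain rfl := W.eq_of_mem_sdiff (hi.mem_sdiff_iff.2 (.inr rfl)) (hj.mem_sdiff_iff.2 rfl)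
  exact hi.1.2.2.1.ne (hj.mem_sdiff_iff.1 (hi.mem_sdiff_iff.2 (.inl rfl)))

theorem IsRegularPair.not_left_of_right {σ τ ρ : Finset V} (h : W.IsRegularPair σ τ) :
    ¬ W.IsRegularPair τ ρ := by
  rintro ⟨j, hj⟩
  obtain ⟨i, hi⟩ := h
  obtain rfl := W.eq_of_mem_sdiff (hi.mem_sdiff_iff.2 (.inr rfl)) (hj.mem_sdiff_iff.2 (.inl rfl))
  -- At a common step, `σ ⊂ τ ⊂ ρ` would contradict that `τ` alone properly contains `σ`.
  exact hj.1.2.2.1.ne'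
    (hi.1.2.2.2 ρ hj.1.2.1 (hi.1.2.2.1.trans hj.1.2.2.1))

variable (W)

theorem exists_mem_sdiff {ν : Finset V} (hν : ν ∈ K) :
    ∃ i : Fin W.length, ν ∈ W.stage i.succ ∧ ν ∉ W.stage i.castSucc := by
  by_contra! h
  have : ∀ i, ν ∉ W.stage i := by
    intro i
    induction i using Fin.induction with
    | zero =>
      intro h0
      change ν ∈ (W.stage 0).faces at h0
      rwa [W.stage_zero] at h0
    | succ i ih => exact fun hi => ih (h i hi)
  apply this (Fin.last _)
  rwa [W.stage_last]

theorem critical_or_regular (ν : K) : W.IsCritical ν ∨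
    (∃ τ : K, W.IsRegularPair ν τ) ∨ ∃ σ : K, W.IsRegularPair σ ν := by
  obtain ⟨i, hi⟩ := W.exists_mem_sdiff ν.2
  rcases W.step i with ⟨μ, h⟩ | ⟨σ, τ, h⟩
  · exact .inl ⟨i, by rwa [h.mem_sdiff_iff.1 hi]⟩
  · have hr : W.IsRegularPair σ τ := ⟨i, h⟩
    rcases h.mem_sdiff_iff.1 hi with h' | h'
    · exact .inr (.inl ⟨⟨τ, hr.mem_right⟩, by rwa [h']⟩)
    · exact .inr (.inr ⟨⟨σ, hr.mem_left⟩, by rwa [h']⟩)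

variable [DecidableEq V] [Fintype K]

/-- Spanning goes by induction along the sequence: when `(σ, τ)` is added, every facet of `τ` other
than `σ` is already present, so `σ` equals `∂τ` plus chains known to be in the span. -/
theorem isAcyclicMatching_bdry :
    W.IsAcyclicMatching (bdry K) fun σ τ => W.IsRegularPair σ τ where
  right_unique h h' := Subtype.ext (h.right_unique h')
  not_critical_left h := h.not_critical_left
  not_critical_right h := h.not_critical_right
  not_left_of_right h := h.not_left_of_right
  exhaustive := W.critical_or_regular
  single_mem_span := by
    suffices H : ∀ i, ∀ ν : K, (ν : Finset V) ∈ W.stage i → Finsupp.single ν 1 ∈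
        Submodule.span (ZMod 2) (W.matchingGenerators (bdry K)
          (fun σ τ => W.IsRegularPair σ τ) (ν : Finset V).card) from
      fun ν => H (Fin.last _) ν (by rw [W.stage_last]; exact ν.2)
    intro i
    induction i using Fin.induction with
    | zero =>
      intro ν h0
      change (ν : Finset V) ∈ (W.stage 0).faces at h0
      rw [W.stage_zero] at h0
      exact h0.elim
    | succ i ih =>
      intro ν hν
      by_cases hν' : (ν : Finset V) ∈ W.stage i.castSucc
      · exact ih ν hν'
      rcases W.critical_or_regular ν with hc | ⟨τ, hτ⟩ | ⟨σ, hσ⟩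
      · exact Submodule.subset_span (.inl ⟨ν, rfl, .inl hc, rfl⟩)
      · have hgen : bdry K (Finsupp.single τ 1) ∈ W.matchingGenerators (bdry K)
            (fun σ τ => W.IsRegularPair σ τ) (ν : Finset V).card :=
          .inr ⟨ν, τ, hτ, rfl, rfl⟩
        replace hgen := Submodule.subset_span (R := ZMod 2) hgen
        obtain ⟨j, hj⟩ := hτ
        obtain rfl := W.eq_of_mem_sdiff ⟨hν, hν'⟩ (hj.mem_sdiff_iff.2 (.inl rfl))
        have hcard := hj.1.card_eq
        rw [bdry, linExt_single] at hgen
        refine single_mem_of_chainOf_mem hgen ?_ fun ρ hρ hne => ?_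
        · simpa [hcard] using hj.1.2.2.1
        · simp only [Finset.mem_filter, Finset.mem_univ, true_and] at hρ
          have hρK : (ρ : Finset V) ∈ W.stage i.succ :=
            ((W.stage i.succ).isRelLowerSet_faces hj.1.2.1).2 hρ.1.1
              (K.isRelLowerSet_faces ρ.2).1
          -- Both are facets of `τ`, so the induction hypothesis for `ρ` concerns the same span.
          rw [show (ν : Finset V).card = (ρ : Finset V).card by omega]
          refine ih ρ ?_
          by_contra hρL
          rcases hj.mem_sdiff_iff.1 ⟨hρK, hρL⟩ with h | h
          · exact hne (Subtype.ext h)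
          · exact hρ.1.ne h
      · exact Submodule.subset_span (.inl ⟨ν, rfl, .inr ⟨σ, hσ⟩, rfl⟩)

/-- Spanning goes by induction from the last stage downwards: a simplex of `K` properly containing
`σ` other than `τ` is absent from the stage where `(σ, τ)` is free, so it enters later, and `τ`
equals `δσ` plus chains known to be in the span. -/
theorem isAcyclicMatching_cobdry :
    W.IsAcyclicMatching (cobdry K) (flip fun σ τ => W.IsRegularPair σ τ) where
  right_unique h h' := Subtype.ext (IsRegularPair.left_unique h h')
  not_critical_left h := IsRegularPair.not_critical_right h
  not_critical_right h := IsRegularPair.not_critical_left h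
  not_left_of_right h h' := IsRegularPair.not_left_of_right h' h
  exhaustive ν := (W.critical_or_regular ν).imp_right Or.symm
  single_mem_span := by
    suffices H : ∀ i, ∀ ν : K, (ν : Finset V) ∉ W.stage i → Finsupp.single ν 1 ∈
        Submodule.span (ZMod 2) (W.matchingGenerators (cobdry K)
          (flip fun σ τ => W.IsRegularPair σ τ) (ν : Finset V).card) by
      refine fun ν => H 0 ν fun h0 => ?_
      change (ν : Finset V) ∈ (W.stage 0).faces at h0
      rw [W.stage_zero] at h0
      exact h0.elim
    intro i
    induction i using Fin.reverseInduction with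
    | last =>
      intro ν hν
      rw [W.stage_last] at hν
      exact absurd ν.2 hν
    | cast i ih =>
      intro ν hν'
      by_cases hν : (ν : Finset V) ∈ W.stage i.succ
      swap
      · exact ih ν hν
      rcases W.critical_or_regular ν with hc | ⟨τ, hτ⟩ | ⟨σ, hσ⟩
      · exact Submodule.subset_span (.inl ⟨ν, rfl, .inl hc, rfl⟩)
      · exact Submodule.subset_span (.inl ⟨ν, rfl, .inr ⟨τ, hτ⟩, rfl⟩)
      · have hgen : cobdry K (Finsupp.single σ 1) ∈ W.matchingGenerators (cobdry K)
            (flip fun σ τ => W.IsRegularPair σ τ) (ν : Finset V).card :=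
          .inr ⟨ν, σ, hσ, rfl, rfl⟩
        replace hgen := Submodule.subset_span (R := ZMod 2) hgen
        obtain ⟨j, hj⟩ := hσ
        obtain rfl := W.eq_of_mem_sdiff ⟨hν, hν'⟩ (hj.mem_sdiff_iff.2 (.inr rfl))
        have hcard := hj.1.card_eq
        rw [cobdry, linExt_single] at hgen
        refine single_mem_of_chainOf_mem hgen ?_ fun ρ hρ hne => ?_
        · simpa [hcard] using hj.1.2.2.1
        · simp only [Finset.mem_filter, Finset.mem_univ, true_and] at hρ
          rw [show (ν : Finset V).card = (ρ : Finset V).card by omega]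
          exact ih ρ fun hρK => hne (Subtype.ext (hj.1.2.2.2 ρ hρK hρ.1))

variable {W} {r : K → Chains K}

theorem isReferenceMap_iff : W.IsReferenceMap r ↔
    W.IsMatchingFrame (bdry K) (fun σ τ => W.IsRegularPair σ τ) r :=
  ⟨fun h => ⟨h.1, h.2.1, fun σ τ hστ => h.2.2 τ ⟨σ, hστ⟩⟩,
    fun h => ⟨h.1, h.2.1, fun τ ⟨σ, hστ⟩ => h.2.2 ⟨σ, hστ.mem_left⟩ τ hστ⟩⟩

theorem isCoreferenceMap_iff : W.IsCoreferenceMap r ↔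
    W.IsMatchingFrame (cobdry K) (flip fun σ τ => W.IsRegularPair σ τ) r :=
  ⟨fun h => ⟨h.1, h.2.1, fun τ σ hστ => h.2.2 σ ⟨τ, hστ⟩⟩,
    fun h => ⟨h.1, h.2.1, fun σ ⟨τ, hστ⟩ => h.2.2 ⟨τ, hστ.mem_right⟩ σ hστ⟩⟩

end Stages

end MorseSequence

/-! ### The main theorem -/

theorem mainTheorem4 {V : Type*} [DecidableEq V] {K : PreAbstractSimplicialComplex V} [Fintype K]
    (W : MorseSequence K) :
    -- `W` has a unique reference map and a unique coreference map
    (∃! r : K → Chains K, W.IsReferenceMap r) ∧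
    (∃! s : K → Chains K, W.IsCoreferenceMap s) ∧
    ∀ r s : K → Chains K, W.IsReferenceMap r → W.IsCoreferenceMap s →
      -- the extension complex and the critical complex
      (IsChainComplex (W.extSpace s) (bdry K) ∧
        IsChainComplex W.criticalChains (MorseSequence.criticalBdry r) ∧
        ∀ p : ℤ, Nonempty
          (HomologySpace (W.extSpace s) (bdry K) p ≃ₗ[ZMod 2]
            HomologySpace W.criticalChains (MorseSequence.criticalBdry r) p)) ∧
      -- the coextension complex and the cocritical complex
      (IsCochainComplex (W.extSpace r) (cobdry K) ∧
        IsCochainComplex W.criticalChains (MorseSequence.cocriticalCobdry s) ∧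
        ∀ p : ℤ, Nonempty
          (CohomologySpace (W.extSpace r) (cobdry K) p ≃ₗ[ZMod 2]
            CohomologySpace W.criticalChains (MorseSequence.cocriticalCobdry s) p)) := by
  have hb := W.isAcyclicMatching_bdry
  have hc := W.isAcyclicMatching_cobdry
  simp only [MorseSequence.isReferenceMap_iff, MorseSequence.isCoreferenceMap_iff]
  refine ⟨?_, ?_, fun r s hr hs => ⟨?_, ?_⟩⟩
  · obtain ⟨r, hr⟩ := hb.exists_frame
    exact ⟨r, hr, fun r' hr' => hb.frame_unique hr' hr⟩
  · obtain ⟨s, hs⟩ := hc.exists_frame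
    exact ⟨s, hs, fun s' hs' => hc.frame_unique hs' hs⟩
  · obtain ⟨h1, h2, h3⟩ := hb.extSpace_homology hc isTransposeOf_cobdry bdry_bdry
      (fun _ _ => bdry_mem_pChains) hr hs
    exact ⟨h1, h2, fun p => h3 p (p + 1)⟩
  -- The cohomological half is the same statement with the two matchings, the two operators and the
  -- two maps exchanged; images now arrive from degree `p - 1`.
  · obtain ⟨h1, h2, h3⟩ := hc.extSpace_homology hb isTransposeOf_cobdry.symm
      (isTransposeOf_cobdry.comp_self bdry_bdry) (fun _ _ => cobdry_mem_pChains) hs hr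
    exact ⟨h1, h2, fun p => h3 p (p - 1)⟩
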